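/- Let $(M,g_M,J)$ be a Kähler manifold, i.e. a $C^\infty$ Riemannian manifold with a $C^\infty$ field of endomorphisms $J$ of $TM$ satisfying $J^2=-\mathrm{id}$, $g_M(JX,JY)=g_M(X,Y)$ and $\nabla J=0$, where $\nabla$ is the Levi-Civita connection of $g_M$. Let $(N,g_N)$ be a Riemannian manifold and let $F:M\to N$ be a Riemannian submersion of $M$ onto $N$, i.e. a surjective $C^\infty$ submersion whose differential $F_*$ preserves the lengths of vectors in $(\ker F_*)^\perp$. Assume that $F$ is v-semi-slant: there are a distribution $\mathcal D_1\subset(\ker F_*)^\perp$ with $J(\mathcal D_1)=\mathcal D_1$ and a constant $\theta$ such that, with $\mathcal D_2$ the orthogonal complement of $\mathcal D_1$ in $(\ker F_*)^\perp$, the angle between $JX$ and the space $(\mathcal D_2)_p$ equals $\theta$ for every $p\in M$ and every nonzero $X\in(\mathcal D_2)_p$. Let $\mathcal V$ and $\mathcal H$ be the orthogonal projections of $TM$ onto $\ker F_*$ and $(\ker F_*)^\perp$. For vertical $X$ write $JX=\phi X+\omega X$ with $\phi X=\mathcal V JX$ and $\omega X=\mathcal H JX$; for horizontal $Z$ put $CZ=\mathcal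 H JZ$. For vector fields $U,W$ on $M$ put $\mathcal T_UW=\mathcal H\nabla_{\mathcal VU}\mathcal VW+\mathcal V\nabla_{\mathcal VU}\mathcal HW$, and for vertical fields $X,Y$ put $\widehat\nabla_XY=\mathcal V\nabla_XY$. Denote by $\Gamma(\ker F_*)$ the $C^\infty$ vector fields on $M$ with values in $\ker F_*$. Then $\ker F_*$ defines a totally geodesic foliation (i.e. $[X,Y]$ and $\nabla_XY$ are vertical for all $X,Y\in\Gamma(\ker F_*)$) if and only if $$\omega\big(\widehat\nabla_X\phi Y+\mathcal T_X\,\omega Y\big)+C\big(\mathcal T_X\,\phi Y+\mathcal H\nabla_X\,\omega Y\big)=0\qquad\text{for all }X,Y\in\Gamma(\ker F_*).$$ -/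

import Mathlib

open Bundle VectorField
open scoped Manifold ContDiff Topology

set_option linter.unusedSectionVars false

namespace VSemiSlant

/-! ### The Levi-Civita connection of a Riemannian manifold -/

noncomputable section LeviCivita

variable {E : Type*} [NormedAddCommGroup E] [NormedSpace ℝ E] [FiniteDimensional ℝ E]
  {H : Type*} [TopologicalSpace H] {I : ModelWithCorners ℝ E H}
  {M : Type*} [TopologicalSpace M] [ChartedSpace H M] [IsManifold I ∞ M]
  [RiemannianBundle (fun x : M ↦ TangentSpace I x)]
  [IsContMDiffRiemannianBundle I ∞ E (fun x : M ↦ TangentSpace I x)]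

/-- Tangent spaces of a finite-dimensional manifold are finite-dimensional. -/
instance tangentSpace_finiteDimensional (x : M) : FiniteDimensional ℝ (TangentSpace I x) :=
  inferInstanceAs (FiniteDimensional ℝ E)

/-- The right-hand side of the Koszul formula: `2 g(∇_X Y, Z) = X g(Y, Z) + Y g(Z, X) - Z g(X, Y)
+ g([X, Y], Z) - g([X, Z], Y) - g([Y, Z], X)`. -/
def koszul (X Y Z : Π x : M, TangentSpace I x) (x : M) : ℝ :=
  mvfderiv I (fun y ↦ inner ℝ (Y y) (Z y)) x (X x)
  + mvfderiv I (fun y ↦ inner ℝ (Z y) (X y)) x (Y x)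
  - mvfderiv I (fun y ↦ inner ℝ (X y) (Y y)) x (Z x)
  + inner ℝ (mlieBracket I X Y x) (Z x)
  - inner ℝ (mlieBracket I X Z x) (Y x)
  - inner ℝ (mlieBracket I Y Z x) (X x)

variable {X X' Y Y' Z Z' : Π x : M, TangentSpace I x} {x : M} {f : M → ℝ}

lemma mdiffAt_inner (hX : MDiffAt (T% X) x) (hY : MDiffAt (T% Y) x) :
    MDiffAt (fun y ↦ inner ℝ (X y) (Y y)) x :=
  MDifferentiableAt.inner_bundle (IB := I) (F := E) (E := fun x : M ↦ TangentSpace I x)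
    (b := fun y ↦ y) hX hY

lemma mvfderiv_inner_smul_left (hf : MDiffAt f x) (hX : MDiffAt (T% X) x)
    (hY : MDiffAt (T% Y) x) (v : TangentSpace I x) :
    mvfderiv I (fun y ↦ inner ℝ ((f • X) y) (Y y)) x v
      = f x * mvfderiv I (fun y ↦ inner ℝ (X y) (Y y)) x v
        + inner ℝ (X x) (Y x) * mvfderiv I f x v := by
  have : (fun y ↦ inner ℝ ((f • X) y) (Y y)) = fun y ↦ f y * inner ℝ (X y) (Y y) := by
    ext y; simp [real_inner_smul_left]
  rw [this, mvfderiv_fun_mul hf (mdiffAt_inner hX hY)]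
  simp

lemma mvfderiv_inner_comm (v : TangentSpace I x) :
    mvfderiv I (fun y ↦ inner ℝ (X y) (Y y)) x v
      = mvfderiv I (fun y ↦ inner ℝ (Y y) (X y)) x v := by
  simp_rw [real_inner_comm]

lemma mvfderiv_inner_add_left (hX : MDiffAt (T% X) x) (hX' : MDiffAt (T% X') x)
    (hY : MDiffAt (T% Y) x) (v : TangentSpace I x) :
    mvfderiv I (fun y ↦ inner ℝ ((X + X') y) (Y y)) x v
      = mvfderiv I (fun y ↦ inner ℝ (X y) (Y y)) x v
        + mvfderiv I (fun y ↦ inner ℝ (X' y) (Y y)) x v := by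
  have : (fun y ↦ inner ℝ ((X + X') y) (Y y))
      = fun y ↦ inner ℝ (X y) (Y y) + inner ℝ (X' y) (Y y) := by
    ext y; simp [inner_add_left]
  rw [this, mvfderiv_fun_add (mdiffAt_inner hX hY) (mdiffAt_inner hX' hY)]
  simp

lemma koszul_smul_left (hf : MDiffAt f x) (hX : MDiffAt (T% X) x) (hY : MDiffAt (T% Y) x)
    (hZ : MDiffAt (T% Z) x) : koszul (f • X) Y Z x = f x * koszul X Y Z x := by
  simp only [koszul]
  rw [mvfderiv_inner_comm (X := Z), mvfderiv_inner_smul_left hf hX hZ,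
    mvfderiv_inner_smul_left hf hX hY, mvfderiv_inner_comm (X := Z),
    mlieBracket_smul_left hf hX, mlieBracket_smul_left hf hX]
  simp only [Pi.smul_apply', map_smul, smul_eq_mul, inner_add_left, real_inner_smul_left,
    real_inner_smul_right]
  ring

lemma koszul_add_left (hX : MDiffAt (T% X) x) (hX' : MDiffAt (T% X') x) (hY : MDiffAt (T% Y) x)
    (hZ : MDiffAt (T% Z) x) : koszul (X + X') Y Z x = koszul X Y Z x + koszul X' Y Z x := by
  simp only [koszul]
  rw [mvfderiv_inner_comm (X := Z), mvfderiv_inner_add_left hX hX' hZ,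
    mvfderiv_inner_add_left hX hX' hY, mvfderiv_inner_comm (X := Z), mvfderiv_inner_comm (X := Z),
    mlieBracket_add_left hX hX', mlieBracket_add_left hX hX']
  simp only [Pi.add_apply, map_add, inner_add_left, inner_add_right]
  ring

lemma koszul_add_swap : koszul X Y Z x + koszul X Z Y x
    = 2 * mvfderiv I (fun y ↦ inner ℝ (Y y) (Z y)) x (X x) := by
  simp only [koszul]
  rw [mvfderiv_inner_comm (X := Z) (Y := Y), mvfderiv_inner_comm (X := Z) (Y := X),
    mvfderiv_inner_comm (X := Y) (Y := X), mlieBracket_swap_apply (V := Z) (W := Y)]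
  simp only [inner_neg_left]
  ring

lemma koszul_sub_swap : koszul X Y Z x - koszul Y X Z x
    = 2 * inner ℝ (mlieBracket I X Y x) (Z x) := by
  simp only [koszul]
  rw [mvfderiv_inner_comm (X := X) (Y := Z), mvfderiv_inner_comm (X := Z) (Y := Y),
    mvfderiv_inner_comm (X := Y) (Y := X), mlieBracket_swap_apply (V := Y) (W := X)]
  simp only [inner_neg_left]
  ring

lemma koszul_smul_right (hf : MDiffAt f x) (hX : MDiffAt (T% X) x) (hY : MDiffAt (T% Y) x)
    (hZ : MDiffAt (T% Z) x) : koszul X Y (f • Z) x = f x * koszul X Y Z x := by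
  simp only [koszul]
  rw [mvfderiv_inner_comm (X := Y), mvfderiv_inner_smul_left hf hZ hY,
    mvfderiv_inner_smul_left hf hZ hX, mvfderiv_inner_comm (X := Z) (Y := Y),
    mlieBracket_smul_right hf hZ, mlieBracket_smul_right hf hZ]
  simp only [Pi.smul_apply', map_smul, smul_eq_mul, inner_add_left, real_inner_smul_left,
    real_inner_smul_right]
  rw [real_inner_comm (X x) (Z x), real_inner_comm (Y x) (Z x)]
  ring

lemma koszul_add_right (hX : MDiffAt (T% X) x) (hY : MDiffAt (T% Y) x)
    (hZ : MDiffAt (T% Z) x) (hZ' : MDiffAt (T% Z') x) :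
    koszul X Y (Z + Z') x = koszul X Y Z x + koszul X Y Z' x := by
  simp only [koszul]
  rw [mvfderiv_inner_comm (X := Y), mvfderiv_inner_add_left hZ hZ' hY,
    mvfderiv_inner_add_left hZ hZ' hX, mvfderiv_inner_comm (X := Z) (Y := Y),
    mvfderiv_inner_comm (X := Z') (Y := Y),
    mlieBracket_add_right hZ hZ', mlieBracket_add_right hZ hZ']
  simp only [Pi.add_apply, map_add, inner_add_left, inner_add_right]
  ring

lemma koszul_add_middle (hX : MDiffAt (T% X) x) (hY : MDiffAt (T% Y) x)
    (hY' : MDiffAt (T% Y') x) (hZ : MDiffAt (T% Z) x) :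
    koszul X (Y + Y') Z x = koszul X Y Z x + koszul X Y' Z x := by
  have h := koszul_sub_swap (X := X) (Y := Y + Y') (Z := Z) (x := x)
  have h1 := koszul_sub_swap (X := X) (Y := Y) (Z := Z) (x := x)
  have h2 := koszul_sub_swap (X := X) (Y := Y') (Z := Z) (x := x)
  rw [koszul_add_left hY hY' hX hZ, mlieBracket_add_right hY hY', inner_add_left] at h
  linarith

lemma koszul_smul_middle (hf : MDiffAt f x) (hX : MDiffAt (T% X) x) (hY : MDiffAt (T% Y) x)
    (hZ : MDiffAt (T% Z) x) : koszul X (f • Y) Z x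
      = f x * koszul X Y Z x + 2 * (mvfderiv I f x (X x) * inner ℝ (Y x) (Z x)) := by
  have h := koszul_sub_swap (X := X) (Y := f • Y) (Z := Z) (x := x)
  have h1 := koszul_sub_swap (X := X) (Y := Y) (Z := Z) (x := x)
  rw [koszul_smul_left hf hY hX hZ, mlieBracket_smul_right hf hY, inner_add_left,
    real_inner_smul_left, real_inner_smul_left] at h
  linear_combination h - f x * h1

/-- For fixed `Y`, the Koszul expression is tensorial in `X` and `Z`; this is the corresponding
bilinear form on the tangent space at `x`. -/
def koszulForm (Y : Π x : M, TangentSpace I x) (x : M) (hY : MDiffAt (T% Y) x) :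
    TangentSpace I x →L[ℝ] TangentSpace I x →L[ℝ] ℝ :=
  TensorialAt.mkHom₂ (I := I) (F := E) (F' := E) (V := fun x : M ↦ TangentSpace I x)
    (V' := fun x : M ↦ TangentSpace I x) (fun X Z ↦ koszul X Y Z x) x
    (fun _ hZ ↦ ⟨fun hf hX ↦ koszul_smul_left hf hX hY hZ,
      fun hX hX' ↦ koszul_add_left hX hX' hY hZ⟩)
    (fun _ hX ↦ ⟨fun hf hZ ↦ koszul_smul_right hf hX hY hZ,
      fun hZ hZ' ↦ koszul_add_right hX hY hZ hZ'⟩)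

lemma koszulForm_apply (hX : MDiffAt (T% X) x) (hY : MDiffAt (T% Y) x) (hZ : MDiffAt (T% Z) x) :
    koszulForm Y x hY (X x) (Z x) = koszul X Y Z x :=
  TensorialAt.mkHom₂_apply (I := I) (F := E) (F' := E) (V := fun x : M ↦ TangentSpace I x)
    (V' := fun x : M ↦ TangentSpace I x) _ _ hX hZ

open scoped Classical in
/-- `∇_v Y` at `x`: the vector that represents `w ↦ (1 / 2) koszul v Y w` for the inner product at
`x`, written in an orthonormal basis (and `0` where `Y` is not differentiable). -/
def leviCivitaFun (Y : Π x : M, TangentSpace I x) (x : M) :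
    TangentSpace I x →L[ℝ] TangentSpace I x :=
  if hY : MDiffAt (T% Y) x then
    ∑ i, ContinuousLinearMap.smulRight
      ((koszulForm Y x hY).flip (stdOrthonormalBasis ℝ (TangentSpace I x) i))
      ((1 / 2 : ℝ) • stdOrthonormalBasis ℝ (TangentSpace I x) i)
  else 0

lemma inner_leviCivitaFun (hX : MDiffAt (T% X) x) (hY : MDiffAt (T% Y) x)
    (hZ : MDiffAt (T% Z) x) :
    2 * inner ℝ (leviCivitaFun Y x (X x)) (Z x) = koszul X Y Z x := by
  have hb : (Z x) = ∑ i, inner ℝ (stdOrthonormalBasis ℝ (TangentSpace I x) i) (Z x) •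
      stdOrthonormalBasis ℝ (TangentSpace I x) i :=
    ((stdOrthonormalBasis ℝ (TangentSpace I x)).sum_repr' (Z x)).symm
  rw [← koszulForm_apply hX hY hZ]
  conv_rhs => rw [hb]
  simp only [leviCivitaFun, hY, dif_pos, sum_apply,
    ContinuousLinearMap.smulRight_apply, ContinuousLinearMap.flip_apply, sum_inner, map_sum,
    map_smul, real_inner_smul_left, Finset.mul_sum, smul_eq_mul]
  exact Finset.sum_congr rfl fun i _ ↦ by ring

lemma inner_leviCivitaFun_extend (hY : MDiffAt (T% Y) x) (v w : TangentSpace I x) :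
    2 * inner ℝ (leviCivitaFun Y x v) w
      = koszul (FiberBundle.extend E v) Y (FiberBundle.extend E w) x := by
  have h := inner_leviCivitaFun (X := FiberBundle.extend E v) (Z := FiberBundle.extend E w)
    (FiberBundle.mdifferentiableAt_extend ..) hY (FiberBundle.mdifferentiableAt_extend ..)
  simpa using h

variable (I M) in
/-- The Levi-Civita connection; `leviCivita I M Y x v` is `∇_v Y` at `x`. It is torsion free and
metric, as the two theorems below show. -/
def leviCivita : CovariantDerivative I E (fun x : M ↦ TangentSpace I x) where
  toFun := leviCivitaFun
  isCovariantDerivativeOnUniv :=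
    { add := by
        intro Y Y' x hY hY' _
        ext1 v
        refine ext_inner_right ℝ fun w ↦ ?_
        have h := inner_leviCivitaFun_extend (mdifferentiableAt_add_section hY hY') v w
        have h1 := inner_leviCivitaFun_extend hY v w
        have h2 := inner_leviCivitaFun_extend hY' v w
        rw [koszul_add_middle (FiberBundle.mdifferentiableAt_extend ..) hY hY'
          (FiberBundle.mdifferentiableAt_extend ..)] at h
        rw [add_apply, inner_add_left]
        linarith
      leibniz := by
        intro Y f x hY hf _
        ext1 v
        refine ext_inner_right ℝ fun w ↦ ?_
        have h := inner_leviCivitaFun_extend (hf.smul_section hY) v w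
        have h1 := inner_leviCivitaFun_extend hY v w
        rw [koszul_smul_middle hf (FiberBundle.mdifferentiableAt_extend ..) hY
          (FiberBundle.mdifferentiableAt_extend ..)] at h
        simp only [FiberBundle.extend_apply_self] at h
        rw [add_apply, inner_add_left, smul_apply,
          ContinuousLinearMap.smulRight_apply, real_inner_smul_left, real_inner_smul_left]
        linear_combination h / 2 - f x * h1 / 2 }

/-- The Levi-Civita connection is torsion free: `∇_X Y - ∇_Y X = [X, Y]`. -/
theorem leviCivita_torsionFree (hX : MDiffAt (T% X) x) (hY : MDiffAt (T% Y) x) :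
    leviCivita I M Y x (X x) - leviCivita I M X x (Y x) = mlieBracket I X Y x := by
  refine ext_inner_right ℝ fun w ↦ ?_
  have hw := FiberBundle.mdifferentiableAt_extend I E w
  have h1 := inner_leviCivitaFun hX hY hw
  have h2 := inner_leviCivitaFun hY hX hw
  have h := koszul_sub_swap (X := X) (Y := Y) (Z := FiberBundle.extend E w) (x := x)
  simp only [FiberBundle.extend_apply_self] at h1 h2 h
  rw [inner_sub_left]
  change inner ℝ (leviCivitaFun Y x (X x)) w - inner ℝ (leviCivitaFun X x (Y x)) w = _
  linarith

/-- The Levi-Civita connection is metric: `v g(Y, Z) = g(∇_v Y, Z) + g(Y, ∇_v Z)`. -/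
theorem leviCivita_metric (hY : MDiffAt (T% Y) x) (hZ : MDiffAt (T% Z) x)
    (v : TangentSpace I x) :
    mvfderiv I (fun y ↦ inner ℝ (Y y) (Z y)) x v
      = inner ℝ (leviCivita I M Y x v) (Z x) + inner ℝ (Y x) (leviCivita I M Z x v) := by
  have hv := FiberBundle.mdifferentiableAt_extend I E v
  have h1 := inner_leviCivitaFun hv hY hZ
  have h2 := inner_leviCivitaFun hv hZ hY
  have h := koszul_add_swap (X := FiberBundle.extend E v) (Y := Y) (Z := Z) (x := x)
  simp only [FiberBundle.extend_apply_self] at h1 h2 h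
  rw [real_inner_comm (leviCivita I M Z x v) (Y x)]
  change _ = inner ℝ (leviCivitaFun Y x v) (Z x) + inner ℝ (leviCivitaFun Z x v) (Y x)
  linarith

end LeviCivita

/-! ### Vector fields, distributions, foliations -/

noncomputable section Fields

variable {E : Type*} [NormedAddCommGroup E] [NormedSpace ℝ E]
  {H : Type*} [TopologicalSpace H] {I : ModelWithCorners ℝ E H}
  {M : Type*} [TopologicalSpace M] [ChartedSpace H M] [IsManifold I ∞ M]

/-- `X ∈ Γ(D)`: `X` is a `C^∞` vector field on `M` with values in `D`. -/
def IsSection (D : Π x : M, Submodule ℝ (TangentSpace I x)) (X : Π x : M, TangentSpace I x) :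
    Prop :=
  ContMDiff I I.tangent ∞ (fun x ↦ (⟨x, X x⟩ : TangentBundle I M)) ∧ ∀ x, X x ∈ D x

/-- `D` is a (smooth) distribution: near every point it is spanned by finitely many pointwise
linearly independent `C^∞` vector fields. -/
def IsDistribution (D : Π x : M, Submodule ℝ (TangentSpace I x)) : Prop :=
  ∀ p : M, ∃ U : Set M, IsOpen U ∧ p ∈ U ∧ ∃ (k : ℕ) (s : Fin k → Π x : M, TangentSpace I x),
    (∀ i, ContMDiffOn I I.tangent ∞ (fun x ↦ (⟨x, s i x⟩ : TangentBundle I M)) U) ∧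
    ∀ x ∈ U, LinearIndependent ℝ (fun i ↦ s i x) ∧
      Submodule.span ℝ (Set.range fun i ↦ s i x) = D x

variable [FiniteDimensional ℝ E]
  [RiemannianBundle (fun x : M ↦ TangentSpace I x)]
  [IsContMDiffRiemannianBundle I ∞ E (fun x : M ↦ TangentSpace I x)]

/-- `∇_X Y` for the Levi-Civita connection. -/
def nabla (X Y : Π x : M, TangentSpace I x) : Π x : M, TangentSpace I x :=
  fun x ↦ leviCivita I M Y x (X x)

/-- The distribution `D` defines a totally geodesic foliation: it is involutive (so that it is
tangent to a foliation) and `∇_X Y` is tangent to `D` for all `X, Y ∈ Γ(D)` (the leaves have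
vanishing second fundamental form). -/
structure DefinesTotallyGeodesicFoliation (D : Π x : M, Submodule ℝ (TangentSpace I x)) :
    Prop where
  involutive : ∀ X Y : Π x : M, TangentSpace I x, IsSection D X → IsSection D Y →
    ∀ x, mlieBracket I X Y x ∈ D x
  totallyGeodesic : ∀ X Y : Π x : M, TangentSpace I x, IsSection D X → IsSection D Y →
    ∀ x, nabla X Y x ∈ D x

/-! ### Almost Hermitian and Kähler manifolds -/

/-- `(M, g, J)` is an almost Hermitian manifold: `J` is a `C^∞` field of endomorphisms of the
tangent spaces with `J² = -id` that preserves the Riemannian metric. -/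
structure IsAlmostHermitian (J : Π x : M, TangentSpace I x →L[ℝ] TangentSpace I x) : Prop where
  smooth : ContMDiff I (I.prod 𝓘(ℝ, E →L[ℝ] E)) ∞
    (fun x ↦ TotalSpace.mk' (E →L[ℝ] E)
      (E := fun x : M ↦ TangentSpace I x →L[ℝ] TangentSpace I x) x (J x))
  sq : ∀ x (v : TangentSpace I x), J x (J x v) = -v
  isometry : ∀ x (v w : TangentSpace I x), inner ℝ (J x v) (J x w) = inner ℝ v w

/-- `(M, g, J)` is a Kähler manifold: it is almost Hermitian and `∇J = 0`, that is,
`∇_v (J Y) = J (∇_v Y)` for all tangent vectors `v` and all `C^∞` vector fields `Y`. -/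
structure IsKaehler (J : Π x : M, TangentSpace I x →L[ℝ] TangentSpace I x) : Prop
    extends IsAlmostHermitian J where
  parallel : ∀ Y : Π x : M, TangentSpace I x,
    ContMDiff I I.tangent ∞ (fun x ↦ (⟨x, Y x⟩ : TangentBundle I M)) →
    ∀ x (v : TangentSpace I x),
      leviCivita I M (fun y ↦ J y (Y y)) x v = J x (leviCivita I M Y x v)

end Fields

/-! ### Riemannian submersions -/

noncomputable section Submersion

variable {E : Type*} [NormedAddCommGroup E] [NormedSpace ℝ E] [FiniteDimensional ℝ E]
  {H : Type*} [TopologicalSpace H] {I : ModelWithCorners ℝ E H}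
  {M : Type*} [TopologicalSpace M] [ChartedSpace H M] [IsManifold I ∞ M]
  [RiemannianBundle (fun x : M ↦ TangentSpace I x)]
  [IsContMDiffRiemannianBundle I ∞ E (fun x : M ↦ TangentSpace I x)]
  {E' : Type*} [NormedAddCommGroup E'] [NormedSpace ℝ E']
  {H' : Type*} [TopologicalSpace H'] {I' : ModelWithCorners ℝ E' H'}
  {N : Type*} [TopologicalSpace N] [ChartedSpace H' N]

variable (I I') in
/-- The vertical distribution `ker F_*`. -/
def vertical (F : M → N) (x : M) : Submodule ℝ (TangentSpace I x) :=
  LinearMap.ker (mfderiv I I' F x).toLinearMap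

variable (I I') in
/-- The horizontal distribution `(ker F_*)^⊥`. -/
def horizontal (F : M → N) (x : M) : Submodule ℝ (TangentSpace I x) :=
  (vertical I I' F x)ᗮ

variable (I I') in
/-- `F` is a Riemannian submersion of `M` onto `N`: a surjective `C^∞` submersion whose
differential preserves the lengths of horizontal vectors. -/
structure IsRiemannianSubmersion [IsManifold I' ∞ N]
    [RiemannianBundle (fun y : N ↦ TangentSpace I' y)] (F : M → N) : Prop where
  submersion : Manifold.IsSubmersion I I' ∞ F
  surjective : Function.Surjective F
  norm_eq : ∀ x, ∀ v ∈ horizontal I I' F x, ‖mfderiv I I' F x v‖ = ‖v‖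

/-- The angle between a vector `v` and a subspace `W`: the angle in `[0, π / 2]` between `v` and its
orthogonal projection to `W` (`π / 2` if the projection vanishes). -/
def angleToSubspace {x : M} (v : TangentSpace I x) (W : Submodule ℝ (TangentSpace I x)) : ℝ :=
  InnerProductGeometry.angle v (W.starProjection v)

variable (I I') in
/-- `F` is a v-semi-slant submersion: a Riemannian submersion with a distribution
`D₁ ⊆ (ker F_*)^⊥` such that `J D₁ = D₁` and, for `D₂` the orthogonal complement of `D₁` in
`(ker F_*)^⊥` (so that `(ker F_*)^⊥ = D₁ ⊕ D₂`), the angle between `J X` and `D₂` at `p` is the same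
number `θ` for all points `p` and all nonzero `X` in `D₂` at `p`. -/
structure IsVSemiSlantSubmersion [IsManifold I' ∞ N]
    [RiemannianBundle (fun y : N ↦ TangentSpace I' y)]
    (J : Π x : M, TangentSpace I x →L[ℝ] TangentSpace I x) (F : M → N) : Prop
    extends IsRiemannianSubmersion I I' F where
  slant : ∃ D₁ : Π x : M, Submodule ℝ (TangentSpace I x),
    IsDistribution D₁ ∧
    (∀ x, D₁ x ≤ horizontal I I' F x) ∧
    (∀ x, (D₁ x).map (J x).toLinearMap = D₁ x) ∧
    ∃ θ : ℝ, ∀ x, ∀ v ∈ (D₁ x)ᗮ ⊓ horizontal I I' F x, v ≠ 0 →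
      angleToSubspace (J x v) ((D₁ x)ᗮ ⊓ horizontal I I' F x) = θ

variable (I I')

/-- The vertical part `𝒱 U` of a vector field `U`. -/
def verPart (F : M → N) (U : Π x : M, TangentSpace I x) : Π x : M, TangentSpace I x :=
  fun x ↦ (vertical I I' F x).starProjection (U x)

/-- The horizontal part `ℋ U` of a vector field `U`. -/
def horPart (F : M → N) (U : Π x : M, TangentSpace I x) : Π x : M, TangentSpace I x :=
  fun x ↦ (horizontal I I' F x).starProjection (U x)

/-- `φ X`, the vertical part of `J X`, used for vertical `X`. -/
def phi (J : Π x : M, TangentSpace I x →L[ℝ] TangentSpace I x) (F : M → N)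
    (X : Π x : M, TangentSpace I x) : Π x : M, TangentSpace I x :=
  verPart I I' F fun x ↦ J x (X x)

/-- `ω X`, the horizontal part of `J X`, used for vertical `X`. -/
def omega (J : Π x : M, TangentSpace I x →L[ℝ] TangentSpace I x) (F : M → N)
    (X : Π x : M, TangentSpace I x) : Π x : M, TangentSpace I x :=
  horPart I I' F fun x ↦ J x (X x)

/-- `C Z`, the horizontal part of `J Z`, used for horizontal `Z`. -/
def opC (J : Π x : M, TangentSpace I x →L[ℝ] TangentSpace I x) (F : M → N)
    (Z : Π x : M, TangentSpace I x) : Π x : M, TangentSpace I x :=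
  horPart I I' F fun x ↦ J x (Z x)

/-- `∇̂_X Y = 𝒱 ∇_X Y`, used for vertical `X` and `Y`. -/
def hatNabla (F : M → N) (X Y : Π x : M, TangentSpace I x) : Π x : M, TangentSpace I x :=
  verPart I I' F (nabla X Y)

/-- The tensor `T_X Y = ℋ ∇_{𝒱 X} 𝒱 Y + 𝒱 ∇_{𝒱 X} ℋ Y`. -/
def tensorT (F : M → N) (X Y : Π x : M, TangentSpace I x) : Π x : M, TangentSpace I x :=
  horPart I I' F (nabla (verPart I I' F X) (verPart I I' F Y)) +
    verPart I I' F (nabla (verPart I I' F X) (horPart I I' F Y))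

end Submersion

end VSemiSlant

/-! Since `∇J = 0` and `J² = -id`, `∇_X Y = -J ∇_X (JY) = -J (∇_X φY + ∇_X ωY)`. For vertical `X`,
the tensor `T_X` supplies the horizontal part of `∇_X φY` and the vertical part of `∇_X ωY`, so the
two brackets in the criterion are the vertical and horizontal parts of `∇_X (JY)`. Applying `J` and
projecting gives `ω(...) + C(...) = -ℋ ∇_X Y` (`IsRiemannianSubmersion.omega_add_opC_eq`), which
vanishes exactly when `∇_X Y` is vertical. Involutivity then follows because the connection is
torsion free.

The analytic point is that splitting `∇_X (JY)` requires `φY` and `ωY` to be differentiable. This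
comes from `g_M(W, ℋU) = g_N(F_* W, F_* U)`: the right side is differentiable when `U` and `W` are,
and `mdiffAt_of_mdiffAt_inner` recovers `ℋU` from such inner products by Cramer's rule for the Gram
matrix of a local frame. -/

namespace VSemiSlant

/-! ### Cramer's rule and differentiability of determinants. -/

section Cramer

-- Cramer's rule without division, from `adj(A) A = det A`. It expresses the solution of a linear
-- system through determinants, whose dependence on parameters is easy to control.
open Matrix in
lemma det_updateCol_mulVec {n R : Type*} [Fintype n] [DecidableEq n] [CommRing R]
    (A : Matrix n n R) (c : n → R) (i : n) :
    (A.updateCol i (A *ᵥ c)).det = A.det * c i := by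
  rw [← cramer_apply, cramer_eq_adjugate_mulVec, mulVec_mulVec, adjugate_mul, smul_mulVec,
    one_mulVec, Pi.smul_apply, smul_eq_mul]

variable {E : Type*} [NormedAddCommGroup E] [NormedSpace ℝ E]
  {H : Type*} [TopologicalSpace H] {I : ModelWithCorners ℝ E H}
  {M : Type*} [TopologicalSpace M] [ChartedSpace H M]

/-- By the Leibniz expansion, the determinant is a polynomial in the entries. -/
lemma mdiffAt_det {n : Type} [Fintype n] [DecidableEq n] {A : M → Matrix n n ℝ} {x : M}
    (hA : ∀ i j, MDiffAt (fun y ↦ A y i j) x) : MDiffAt (fun y ↦ (A y).det) x := by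
  have hterm : ∀ σ ∈ (Finset.univ : Finset (Equiv.Perm n)), MDiffAt
      ((fun _ : M ↦ ((Equiv.Perm.sign σ : ℤ) : ℝ)) * ∏ i, fun y ↦ A y (σ i) i) x := fun σ _ ↦
    mdifferentiableAt_const.mul (MDifferentiableAt.prod fun i _ ↦ hA (σ i) i)
  convert! MDifferentiableAt.sum hterm using 1
  ext y
  simp [Matrix.det_apply', Finset.sum_apply, Finset.prod_apply]

end Cramer

/-! ### Differentiability of a vector field tested by inner products. -/

section Riesz

variable {E : Type*} [NormedAddCommGroup E] [NormedSpace ℝ E] [FiniteDimensional ℝ E]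
  {H : Type*} [TopologicalSpace H] {I : ModelWithCorners ℝ E H}
  {M : Type*} [TopologicalSpace M] [ChartedSpace H M] [IsManifold I ∞ M]
  [RiemannianBundle (fun x : M ↦ TangentSpace I x)]
  [IsContMDiffRiemannianBundle I ∞ E (fun x : M ↦ TangentSpace I x)]

/-- A vector field is differentiable once its inner products with differentiable vector fields
are. -/
lemma mdiffAt_of_mdiffAt_inner {Z : Π x : M, TangentSpace I x} {x : M}
    (hZ : ∀ W : Π x : M, TangentSpace I x, MDiffAt (T% W) x →
      MDiffAt (fun y ↦ (inner ℝ (W y) (Z y) : ℝ)) x) : MDiffAt (T% Z) x := by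
  classical
  set e := trivializationAt E (fun x : M ↦ TangentSpace I x) x
  set b := Module.finBasis ℝ E
  have hs := e.isLocalFrameOn_localFrame_baseSet I 1 b
  have hx : e.baseSet ∈ 𝓝 x :=
    e.open_baseSet.mem_nhds (FiberBundle.mem_baseSet_trivializationAt' x)
  have hd : ∀ i, MDiffAt (T% (e.localFrame b i)) x := fun i ↦
    ((hs.contMDiffOn i).contMDiffAt hx).mdifferentiableAt one_ne_zero
  set G : M → Matrix _ _ ℝ := fun y ↦ Matrix.gram ℝ (fun i ↦ e.localFrame b i y)
  have hG : ∀ i j, MDiffAt (fun y ↦ G y i j) x := fun i j ↦ mdiffAt_inner (hd i) (hd j)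
  -- The frame is linearly independent on the base set, so its Gram matrix is positive definite
  -- there.
  have hdet : ∀ y ∈ e.baseSet, (G y).det ≠ 0 := fun y hy ↦
    (Matrix.posDef_gram_of_linearIndependent (hs.linearIndependent hy)).det_pos.ne'
  refine hs.mdifferentiableAt_of_coeff (fun i ↦ ?_) hx
  -- The Cramer numerator: column `i` holds the inner products of `Z` with the frame, differentiable
  -- by `hZ`; the other columns are those of `G`.
  have hnum : MDiffAt (fun y ↦ ((G y).updateCol i
      fun j ↦ (inner ℝ (e.localFrame b j y) (Z y) : ℝ)).det) x := by
    refine mdiffAt_det fun j k ↦ ?_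
    by_cases h : k = i
    · subst h
      simpa using hZ _ (hd j)
    · simpa [h] using hG j k
  -- Near `x`, the `i`-th coefficient of `Z` in the frame is this quotient of determinants.
  refine (hnum.div (mdiffAt_det hG) (hdet x (mem_of_mem_nhds hx))).congr_of_eventuallyEq ?_
  filter_upwards [hx] with y hy
  have hv : (fun j ↦ (inner ℝ (e.localFrame b j y) (Z y) : ℝ))
      = (G y).mulVec fun i ↦ hs.coeff i y (Z y) := by
    ext j
    conv_lhs => rw [hs.coeff_sum_eq Z hy]
    simp [G, Matrix.mulVec, dotProduct, Matrix.gram, inner_sum, real_inner_smul_right, mul_comm]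
  simp only [Pi.div_apply]
  rw [hv, det_updateCol_mulVec, mul_div_cancel_left₀ _ (hdet y hy)]
  rfl

end Riesz

section Submersion

variable {E : Type*} [NormedAddCommGroup E] [NormedSpace ℝ E] [FiniteDimensional ℝ E]
  {H : Type*} [TopologicalSpace H] {I : ModelWithCorners ℝ E H}
  {M : Type*} [TopologicalSpace M] [ChartedSpace H M] [IsManifold I ∞ M]
  [RiemannianBundle (fun x : M ↦ TangentSpace I x)]
  [IsContMDiffRiemannianBundle I ∞ E (fun x : M ↦ TangentSpace I x)]
  {E' : Type*} [NormedAddCommGroup E'] [NormedSpace ℝ E']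
  {H' : Type*} [TopologicalSpace H'] {I' : ModelWithCorners ℝ E' H'}
  {N : Type*} [TopologicalSpace N] [ChartedSpace H' N]

/-! ### Algebra of the vertical and horizontal projections. -/

section Projections

variable (I I') in
lemma verPart_add_horPart (F : M → N) (U : Π x : M, TangentSpace I x) :
    verPart I I' F U + horPart I I' F U = U :=
  funext fun x ↦ (vertical I I' F x).starProjection_add_starProjection_orthogonal (U x)

variable (I I') in
lemma horPart_verPart (F : M → N) (U : Π x : M, TangentSpace I x) :
    horPart I I' F (verPart I I' F U) = 0 := by
  funext x
  refine (Submodule.starProjection_apply_eq_zero_iff _).2 ?_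
  exact Submodule.le_orthogonal_orthogonal _ (Submodule.starProjection_apply_mem _ _)

variable (I I') in
lemma verPart_horPart (F : M → N) (U : Π x : M, TangentSpace I x) :
    verPart I I' F (horPart I I' F U) = 0 := by
  funext x
  exact (Submodule.starProjection_apply_eq_zero_iff _).2 (Submodule.starProjection_apply_mem _ _)

variable (I I') in
lemma verPart_verPart (F : M → N) (U : Π x : M, TangentSpace I x) :
    verPart I I' F (verPart I I' F U) = verPart I I' F U := by
  funext x
  exact Submodule.starProjection_eq_self_iff.2 (Submodule.starProjection_apply_mem _ _)

variable (I I') in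
lemma horPart_horPart (F : M → N) (U : Π x : M, TangentSpace I x) :
    horPart I I' F (horPart I I' F U) = horPart I I' F U := by
  funext x
  exact Submodule.starProjection_eq_self_iff.2 (Submodule.starProjection_apply_mem _ _)

variable (I I') in
lemma horPart_add (F : M → N) (U V : Π x : M, TangentSpace I x) :
    horPart I I' F (U + V) = horPart I I' F U + horPart I I' F V :=
  funext fun _ ↦ map_add _ _ _

variable {F : M → N}

lemma verPart_of_mem {U : Π x : M, TangentSpace I x} (hU : ∀ x, U x ∈ vertical I I' F x) :
    verPart I I' F U = U :=
  funext fun x ↦ Submodule.starProjection_eq_self_iff.2 (hU x)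

/-- Rests on `Vᗮᗮ = V` in a finite-dimensional tangent space. It translates between the vanishing of
`ℋ ∇_X Y` and verticality of `∇_X Y`. -/
lemma horPart_apply_eq_zero_iff {U : Π x : M, TangentSpace I x} {x : M} :
    horPart I I' F U x = 0 ↔ U x ∈ vertical I I' F x := by
  refine (Submodule.starProjection_apply_eq_zero_iff _).trans ?_
  rw [horizontal, Submodule.orthogonal_orthogonal]

end Projections

/-! ### Differentiability of the projections of a Riemannian submersion. -/

variable [IsManifold I' ∞ N] [RiemannianBundle (fun y : N ↦ TangentSpace I' y)]
  {F : M → N}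

/-- The differential of a Riemannian submersion preserves inner products of horizontal vectors. -/
lemma IsRiemannianSubmersion.inner_map_map (hF : IsRiemannianSubmersion I I' F) {x : M}
    {v w : TangentSpace I x} (hv : v ∈ horizontal I I' F x) (hw : w ∈ horizontal I I' F x) :
    (inner ℝ (mfderiv I I' F x v) (mfderiv I I' F x w) : ℝ) = inner ℝ v w := by
  -- Polarization: preserving lengths on a subspace implies preserving inner products.
  rw [real_inner_eq_norm_add_mul_self_sub_norm_mul_self_sub_norm_mul_self_div_two,
    real_inner_eq_norm_add_mul_self_sub_norm_mul_self_sub_norm_mul_self_div_two,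
    ← map_add, hF.norm_eq x _ hv, hF.norm_eq x _ hw, hF.norm_eq x _ (add_mem hv hw)]

lemma mfderiv_horPart (U : Π x : M, TangentSpace I x) (x : M) :
    mfderiv I I' F x (horPart I I' F U x) = mfderiv I I' F x (U x) := by
  have h : mfderiv I I' F x (verPart I I' F U x) = 0 :=
    Submodule.starProjection_apply_mem (vertical I I' F x) (U x)
  conv_rhs => rw [← verPart_add_horPart I I' F U]
  rw [Pi.add_apply, map_add, h, zero_add]

/-- `F_*` kills vertical parts and is isometric on horizontal ones. The right side no longer
mentions the projection, so its regularity is that of `F_*` and the metric of `N`. -/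
lemma IsRiemannianSubmersion.inner_horPart (hF : IsRiemannianSubmersion I I' F)
    (U W : Π x : M, TangentSpace I x) (x : M) :
    (inner ℝ (W x) (horPart I I' F U x) : ℝ)
      = inner ℝ (mfderiv I I' F x (W x)) (mfderiv I I' F x (U x)) := by
  rw [← mfderiv_horPart W, ← mfderiv_horPart U,
    hF.inner_map_map (v := horPart I I' F W x) (w := horPart I I' F U x)
      (Submodule.starProjection_apply_mem _ _) (Submodule.starProjection_apply_mem _ _)]
  -- The projection is self-adjoint and idempotent, so projecting `W` as well changes nothing.
  refine Eq.trans ?_ (Submodule.inner_starProjection_left_eq_right _ _ _).symm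
  exact congrArg _ (congrFun (horPart_horPart I I' F U) x).symm

variable [IsContMDiffRiemannianBundle I' ∞ E' (fun y : N ↦ TangentSpace I' y)]

lemma IsRiemannianSubmersion.mdiffAt_horPart (hF : IsRiemannianSubmersion I I' F)
    {U : Π x : M, TangentSpace I x} {x : M} (hU : MDiffAt (T% U) x) :
    MDiffAt (T% (horPart I I' F U)) x := by
  -- `F_* V`, as a field along `F`, is the tangent map of `F` composed with the section `V`.
  have hd : ∀ V : Π x : M, TangentSpace I x, MDiffAt (T% V) x → MDiffAt
      (fun y ↦ (⟨F y, mfderiv I I' F y (V y)⟩ : TangentBundle I' N)) x := fun V hV ↦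
    ((hF.submersion.contMDiff.contMDiff_tangentMap (m := 1) (by norm_cast)).mdifferentiable
      one_ne_zero).mdifferentiableAt.comp x hV
  refine mdiffAt_of_mdiffAt_inner fun W hW ↦ ?_
  simp only [hF.inner_horPart]
  exact MDifferentiableAt.inner_bundle (IB := I') (F := E') (E := fun y : N ↦ TangentSpace I' y)
    (hd W hW) (hd U hU)

lemma IsRiemannianSubmersion.mdiffAt_verPart (hF : IsRiemannianSubmersion I I' F)
    {U : Π x : M, TangentSpace I x} {x : M} (hU : MDiffAt (T% U) x) :
    MDiffAt (T% (verPart I I' F U)) x := by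
  have h : verPart I I' F U = U - horPart I I' F U :=
    eq_sub_of_add_eq (verPart_add_horPart I I' F U)
  rw [h]
  exact mdifferentiableAt_sub_section hU (hF.mdiffAt_horPart hU)

/-! ### The Kähler identity and the criterion. -/

lemma IsAlmostHermitian.contMDiff_apply {J : Π x : M, TangentSpace I x →L[ℝ] TangentSpace I x}
    (hJ : IsAlmostHermitian J) {Y : Π x : M, TangentSpace I x}
    (hY : ContMDiff I I.tangent ∞ (T% Y)) :
    ContMDiff I I.tangent ∞ (T% fun x ↦ J x (Y x)) :=
  ContMDiff.clm_bundle_apply (F₁ := E) (F₂ := E) (b := fun x : M ↦ x) hJ.smooth hY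

/-- On a Kähler manifold, the horizontal part of `∇_X Y` is recovered from the vertical and
horizontal parts of `J Y`. -/
lemma IsRiemannianSubmersion.omega_add_opC_eq (hF : IsRiemannianSubmersion I I' F)
    {J : Π x : M, TangentSpace I x →L[ℝ] TangentSpace I x} (hJ : IsKaehler J)
    {X Y : Π x : M, TangentSpace I x} (hX : IsSection (vertical I I' F) X)
    (hY : ContMDiff I I.tangent ∞ (T% Y)) :
    omega I I' J F (hatNabla I I' F X (phi I I' J F Y) + tensorT I I' F X (omega I I' J F Y))
      + opC I I' J F (tensorT I I' F X (phi I I' J F Y)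
        + horPart I I' F (nabla X (omega I I' J F Y))) = - horPart I I' F (nabla X Y) := by
  have hJY : ∀ x, MDiffAt (T% fun x ↦ J x (Y x)) x := fun x ↦
    (hJ.contMDiff_apply hY x).mdifferentiableAt (by simp)
  have hzero : nabla X (0 : Π x : M, TangentSpace I x) = 0 := by
    funext x
    simp [nabla]
  have hX' := verPart_of_mem hX.2
  have hver : (verPart I I' F (0 : Π x : M, TangentSpace I x)) = 0 := funext fun x ↦ map_zero _
  have hhor : (horPart I I' F (0 : Π x : M, TangentSpace I x)) = 0 := funext fun x ↦ map_zero _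
  -- On a horizontal or a vertical argument only one of the two terms of `T_X` survives.
  have hTω : tensorT I I' F X (omega I I' J F Y)
      = verPart I I' F (nabla X (omega I I' J F Y)) := by
    rw [tensorT, hX', omega, verPart_horPart, horPart_horPart, hzero, hhor, zero_add]
  have hTφ : tensorT I I' F X (phi I I' J F Y) = horPart I I' F (nabla X (phi I I' J F Y)) := by
    rw [tensorT, hX', phi, verPart_verPart, horPart_verPart, hzero, hver, add_zero]
  -- Additivity of `∇_X` applies because both parts of `JY` are differentiable; `∇J = 0` then moves
  -- `J` outside.
  have hsum : nabla X (phi I I' J F Y) + nabla X (omega I I' J F Y)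
      = fun x ↦ J x (nabla X Y x) := by
    funext x
    have h := (leviCivita I M).isCovariantDerivativeOnUniv.add
      (hF.mdiffAt_verPart (hJY x)) (hF.mdiffAt_horPart (hJY x)) (Set.mem_univ x)
    rw [verPart_add_horPart] at h
    have h' := hJ.parallel Y hY x (X x)
    exact (congrArg (fun L ↦ L (X x)) h).symm.trans h'
  rw [hTω, hTφ, hatNabla, omega, opC, ← horPart_add]
  have hneg : - horPart I I' F (nabla X Y) = horPart I I' F (- nabla X Y) :=
    funext fun x ↦ (map_neg _ _).symm
  rw [hneg]
  congr 1
  funext x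
  have h1 := congrFun (verPart_add_horPart I I' F (nabla X (phi I I' J F Y))) x
  have h2 := congrFun (verPart_add_horPart I I' F (nabla X (omega I I' J F Y))) x
  have h3 := congrFun hsum x
  have h4 := hJ.sq x (nabla X Y x)
  simp only [Pi.add_apply, Pi.neg_apply] at h1 h2 h3 ⊢
  -- Write `-∇_X Y` as `J (J ∇_X Y) = J (∇_X φY + ∇_X ωY)`; splitting both summands into vertical
  -- and horizontal parts matches the left side up to order.
  rw [← h4, ← h3, ← map_add]
  conv_rhs => rw [← h1, ← h2]
  congr 1
  abel

/-- If `∇_X Y` is tangent to `D` for all `X, Y ∈ Γ(D)`, then `D` is involutive. -/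
lemma DefinesTotallyGeodesicFoliation.of_nabla_mem {D : Π x : M, Submodule ℝ (TangentSpace I x)}
    (h : ∀ X Y : Π x : M, TangentSpace I x, IsSection D X → IsSection D Y →
      ∀ x, nabla X Y x ∈ D x) : DefinesTotallyGeodesicFoliation D where
  involutive X Y hX hY x := by
    rw [← leviCivita_torsionFree ((hX.1 x).mdifferentiableAt (by simp))
      ((hY.1 x).mdifferentiableAt (by simp))]
    exact sub_mem (h X Y hX hY x) (h Y X hY hX x)
  totallyGeodesic := h

end Submersion

end VSemiSlant

theorem proposition3p11
    {E : Type*} [NormedAddCommGroup E] [NormedSpace ℝ E] [FiniteDimensional ℝ E]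
    {M : Type*} [TopologicalSpace M] [T2Space M] [SecondCountableTopology M]
    [ChartedSpace E M] [IsManifold 𝓘(ℝ, E) ∞ M]
    [RiemannianBundle (fun x : M ↦ TangentSpace 𝓘(ℝ, E) x)]
    [IsContMDiffRiemannianBundle 𝓘(ℝ, E) ∞ E (fun x : M ↦ TangentSpace 𝓘(ℝ, E) x)]
    {E' : Type*} [NormedAddCommGroup E'] [NormedSpace ℝ E'] [FiniteDimensional ℝ E']
    {N : Type*} [TopologicalSpace N] [T2Space N] [SecondCountableTopology N]
    [ChartedSpace E' N] [IsManifold 𝓘(ℝ, E') ∞ N]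
    [RiemannianBundle (fun y : N ↦ TangentSpace 𝓘(ℝ, E') y)]
    [IsContMDiffRiemannianBundle 𝓘(ℝ, E') ∞ E' (fun y : N ↦ TangentSpace 𝓘(ℝ, E') y)]
    (J : ∀ x : M, TangentSpace 𝓘(ℝ, E) x →L[ℝ] TangentSpace 𝓘(ℝ, E) x)
    (hJ : VSemiSlant.IsKaehler J)
    (F : M → N) (hF : VSemiSlant.IsVSemiSlantSubmersion 𝓘(ℝ, E) 𝓘(ℝ, E') J F) :
    VSemiSlant.DefinesTotallyGeodesicFoliation (VSemiSlant.vertical 𝓘(ℝ, E) 𝓘(ℝ, E') F) ↔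
      ∀ X Y : (∀ x : M, TangentSpace 𝓘(ℝ, E) x),
        VSemiSlant.IsSection (VSemiSlant.vertical 𝓘(ℝ, E) 𝓘(ℝ, E') F) X →
        VSemiSlant.IsSection (VSemiSlant.vertical 𝓘(ℝ, E) 𝓘(ℝ, E') F) Y →
        VSemiSlant.omega 𝓘(ℝ, E) 𝓘(ℝ, E') J F
            (VSemiSlant.hatNabla 𝓘(ℝ, E) 𝓘(ℝ, E') F X
                (VSemiSlant.phi 𝓘(ℝ, E) 𝓘(ℝ, E') J F Y)
              + VSemiSlant.tensorT 𝓘(ℝ, E) 𝓘(ℝ, E') F X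
                (VSemiSlant.omega 𝓘(ℝ, E) 𝓘(ℝ, E') J F Y))
          + VSemiSlant.opC 𝓘(ℝ, E) 𝓘(ℝ, E') J F
            (VSemiSlant.tensorT 𝓘(ℝ, E) 𝓘(ℝ, E') F X
                (VSemiSlant.phi 𝓘(ℝ, E) 𝓘(ℝ, E') J F Y)
              + VSemiSlant.horPart 𝓘(ℝ, E) 𝓘(ℝ, E') F
                (VSemiSlant.nabla X (VSemiSlant.omega 𝓘(ℝ, E) 𝓘(ℝ, E') J F Y)))
          = 0 := by
  have key := fun X Y : (∀ x : M, TangentSpace 𝓘(ℝ, E) x) ↦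
    hF.toIsRiemannianSubmersion.omega_add_opC_eq hJ (X := X) (Y := Y)
  constructor
  · intro h X Y hX hY
    rw [key X Y hX hY.1, neg_eq_zero]
    exact funext fun x ↦ VSemiSlant.horPart_apply_eq_zero_iff.2 (h.totallyGeodesic X Y hX hY x)
  · intro h
    refine .of_nabla_mem fun X Y hX hY x ↦ VSemiSlant.horPart_apply_eq_zero_iff.1 ?_
    have h' := h X Y hX hY
    rw [key X Y hX hY.1, neg_eq_zero] at h'
    exact congrFun h' x
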